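/- Let $G=(V,E)$ be a finite undirected graph with edge weights $w\colon E\to\mathbb{R}_{\ge 0}$, let $T\subseteq V$ be a nonempty set of $k$ terminals, and write $w(Y)=\sum_{e\in Y}w(e)$ for $Y\subseteq E$. A Steiner tree is a set $X\subseteq E$ such that all terminals lie in the same connected component of $(V,X)$. For a weight function $u\colon E\to\mathbb{R}_{\ge0}$, the metric closure of the terminals with respect to $u$ is the complete graph $(T,\binom{T}{2})$ in which the cost of an edge $\{t_1,t_2\}$ is the length of a shortest $t_1$–$t_2$ path in $G$ with respect to $u$. Given a set $\widehat X\subseteq E$ of predicted edges and a parameter $\alpha\ge 1$, consider the following algorithm. Put $w_\alpha(e)=w(e)/\alpha$ for $e\in\widehat X$ and $w_\alpha(e)=w(e)$ for $e\in E\setminus\widehat X$. Compute a minimum spanning tree $\mathrm{MST}_\alpha$ of the metric closure of the terminals with respect to $w_\alpha$. For every edge $e=\{t_1,t_2\}$ of $\mathrm{MST}_\alpha$ choose a cheapest $t_1$–$t_2$ path $p(e)\subseteq E$ in $G$ with respect to $w_\alpha$. Output $X=\bigcup_{e\in \mathrm{MST}_\alpha}p(e)$. **Theorem.** Let $X'\subseteq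 E$ be any Steiner tree, let $\eta^+=w(\widehat X\setminus X')$ and $\eta^-=w(X'\setminus\widehat X)$, let $\mathbf{c}$ denote the edge costs of the metric closure of the terminals with respect to the original weights $w$, let $\mathrm{MST}$ be a minimum spanning tree of $(T,\binom T2)$ with respect to $\mathbf{c}$, and let $S$ be a set of $\min\{k-1,|\widehat X\setminus X'|\}$ edges of $\mathrm{MST}$ of highest cost. Then the algorithm produces an output, and, whatever minimum spanning tree $\mathrm{MST}_\alpha$ and cheapest paths $p(e)$ it chooses, its output $X$ is a Steiner tree with $$w(X)\le\Bigl(1+\frac1\alpha\Bigr)w(X')+\Bigl(1-\frac1\alpha\Bigr)\eta^-+\min\Bigl\{\eta^+,\ (\alpha-1)\sum_{e\in S}\mathbf{c}(e)\Bigr\}.$$ -/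

import Mathlib

namespace SteinerPrediction

/-- The total weight `w(X)` of a finite set of edges. -/
def weight {ι : Type*} (w : ι → ℝ) (X : Finset ι) : ℝ := ∑ e ∈ X, w e

/-- A Steiner tree (feasible solution) for the terminals `T`: a set `X ⊆ E` of edges such that
all terminals belong to the same connected component of `(V, X)`. -/
def IsSteinerTree {V : Type*} (G : SimpleGraph V) (T : Finset V) (X : Finset (Sym2 V)) : Prop :=
  (X : Set (Sym2 V)) ⊆ G.edgeSet ∧
    ∀ s ∈ T, ∀ t ∈ T, (SimpleGraph.fromEdgeSet (X : Set (Sym2 V))).Reachable s t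

/-- `P` is the set of edges of a path in `G` that joins the two ends of the pair `e`. -/
def IsPathEdges {V : Type*} (G : SimpleGraph V) (e : Sym2 V) (P : Finset (Sym2 V)) : Prop :=
  ∃ (u v : V) (p : G.Walk u v), p.IsPath ∧ s(u, v) = e ∧ ∀ x, x ∈ P ↔ x ∈ p.edges

/-- `P` is (the edge set of) a cheapest path in `G` between the ends of `e`, with respect to the
edge weights `w`. -/
def IsCheapestPath {V : Type*} (G : SimpleGraph V) (w : Sym2 V → ℝ) (e : Sym2 V)
    (P : Finset (Sym2 V)) : Prop :=
  IsPathEdges G e P ∧ ∀ Q, IsPathEdges G e Q → weight w P ≤ weight w Q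

/-- The cost of the pair `e` of terminals in the metric closure: the length, with respect to `w`,
of a shortest path in `G` between its ends (meaningful when the ends are connected in `G`). -/
noncomputable def closureCost {V : Type*} (G : SimpleGraph V) (w : Sym2 V → ℝ) {T : Finset V}
    (e : Sym2 T) : ℝ :=
  sInf {l : ℝ | ∃ P, IsPathEdges G (e.map Subtype.val) P ∧ l = weight w P}

/-- `F` is the edge set of a spanning tree of the complete graph on the vertex type `U`. -/
def IsSpanningTree {U : Type*} (F : Finset (Sym2 U)) : Prop :=
  (F : Set (Sym2 U)) ⊆ (⊤ : SimpleGraph U).edgeSet ∧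
    (SimpleGraph.fromEdgeSet (F : Set (Sym2 U))).IsTree

/-- `F` is a minimum spanning tree of the complete graph on `U` with edge costs `c`. -/
def IsMST {U : Type*} (c : Sym2 U → ℝ) (F : Finset (Sym2 U)) : Prop :=
  IsSpanningTree F ∧ ∀ F', IsSpanningTree F' → weight c F ≤ weight c F'

/-- `S` consists of `m` edges of `F` of highest cost. -/
def IsMostExpensive {ι : Type*} (c : ι → ℝ) (F : Finset ι) (m : ℕ) (S : Finset ι) : Prop :=
  S ⊆ F ∧ S.card = m ∧ ∀ e ∈ S, ∀ f ∈ F, f ∉ S → c f ≤ c e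

/-- The weights in which predicted edges are scaled down by the factor `α`. -/
noncomputable def scaledWeight {V : Type*} [DecidableEq V] (w : Sym2 V → ℝ)
    (Xhat : Finset (Sym2 V)) (α : ℝ) (e : Sym2 V) : ℝ :=
  if e ∈ Xhat then w e / α else w e

/-- `X` is a possible output of the algorithm with parameter `α` and prediction `Xhat`: for some
minimum spanning tree `F` of the metric closure of the terminals with respect to the scaled
weights, and some choice `p` of a cheapest path (for the scaled weights) for each edge of `F`,
the set `X` is the union of the chosen paths. -/
def IsOutput {V : Type*} [DecidableEq V] (G : SimpleGraph V) (w : Sym2 V → ℝ) (T : Finset V)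
    (Xhat : Finset (Sym2 V)) (α : ℝ) (X : Finset (Sym2 V)) : Prop :=
  ∃ (F : Finset (Sym2 T)) (p : Sym2 T → Finset (Sym2 V)),
    IsMST (closureCost G (scaledWeight w Xhat α)) F ∧
    (∀ e ∈ F, IsCheapestPath G (scaledWeight w Xhat α) (e.map Subtype.val) (p e)) ∧
    X = F.biUnion p

end SteinerPrediction

open SimpleGraph

namespace SteinerPrediction

/-! ### Reachability and a closed walk that doubles edges. -/

section Graph

variable {V : Type*}

/-! Write w_α for the scaled weights. Shortcutting a closed walk that uses each edge of X' at most
twice gives the classical bound w_α(X) ≤ 2 w_α(X') (`IsSteinerTree.exists_isSpanningTree_le`).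
Passing back to w costs (1 - 1/α) w(X ∩ X̂), and w(X ∩ X̂) ≤ w(X' ∩ X̂) + w(Z) with Z = (X ∩ X̂) \
X'. The terms without Z sum to exactly (1 + 1/α) w(X') + (1 - 1/α) η⁻.

It remains to bound (1 - 1/α) w(Z) = (α - 1) w_α(Z). It is at most η⁺ because Z ⊆ X̂ \ X'. For the
other bound, cover Z by the paths of at most min(k - 1, |X̂ \ X'|) edges of MST_α. By Hall's theorem
and edge exchange, MST_α injects into any spanning tree without decreasing w_α-costs
(`IsMST.exists_injective_le`). These paths are therefore charged to distinct edges of MST, whose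
total cost is at most that of S. -/

theorem reachable_of_adj_reachable {H K : SimpleGraph V} (h : ∀ u v, H.Adj u v → K.Reachable u v)
    {u v : V} (huv : H.Reachable u v) : K.Reachable u v := by
  obtain ⟨p⟩ := huv
  induction p with
  | nil => exact Reachable.refl _
  | cons hadj _ ih => exact (h _ _ hadj).trans ih

/-- Removing an edge of a path leaves its ends reachable from the ends of the edge. -/
theorem reachable_split_of_mem_edges {H K : SimpleGraph V} {e : Sym2 V}
    (h : ∀ u v, H.Adj u v → s(u, v) ≠ e → K.Adj u v) {u v : V} (p : H.Walk u v) (hp : p.IsPath)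
    (he : e ∈ p.edges) : ∃ x y, e = s(x, y) ∧ K.Reachable u x ∧ K.Reachable y v := by
  induction p with
  | nil => simp at he
  | @cons a b c hab q ih =>
    rw [Walk.cons_isPath_iff] at hp
    by_cases hea : e = s(a, b)
    · refine ⟨a, b, hea, Reachable.refl _, ?_⟩
      -- A path does not return to `a`, so its tail avoids `e` and lies in `K`.
      have hq : ∀ f ∈ q.edges, f ∈ K.edgeSet := by
        intro f hf
        have hfH := q.edges_subset_edgeSet hf
        induction f with
        | _ x y =>
          refine h x y hfH ?_
          rintro hxy
          rw [hxy, hea] at hf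
          exact hp.2 (q.fst_mem_support_of_mem_edges hf)
      exact ⟨q.transfer K hq⟩
    · rw [Walk.edges_cons, List.mem_cons] at he
      obtain ⟨x, y, hxy, hx, hy⟩ := ih hp.1 (he.resolve_left hea)
      exact ⟨x, y, hxy, (h a b hab (Ne.symm hea)).reachable.trans hx, hy⟩

/-- A closed walk through a whole component that uses each edge at most twice. -/
theorem exists_closed_walk_count_le_two [Fintype V] [DecidableEq V] (H : SimpleGraph V) (r : V) :
    ∃ p : H.Walk r r, (∀ e, p.edges.count e ≤ 2) ∧ ∀ v, H.Reachable r v → v ∈ p.support := by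
  by_contra! hcon
  -- A walk missing a reachable vertex can be extended by a detour to a new neighbour and back. The
  -- detour edge was unused before, so it is now used exactly twice. The vertex count would grow
  -- beyond `Fintype.card V`.
  have key : ∀ n : ℕ, ∃ p : H.Walk r r, (∀ e, p.edges.count e ≤ 2) ∧
      n ≤ p.support.toFinset.card := by
    intro n
    induction n with
    | zero => exact ⟨Walk.nil, by simp, Nat.zero_le _⟩
    | succ n ih =>
      obtain ⟨p, hp, hn⟩ := ih
      obtain ⟨v, ⟨q⟩, hvp⟩ := hcon p hp
      obtain ⟨d, -, ha, hb⟩ := q.exists_boundary_dart {x | x ∈ p.support} (by simp) hvp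
      obtain ⟨⟨a, b⟩, hab⟩ := d
      simp only [Set.mem_ofPred_eq] at ha hb
      have hsplit := p.take_spec ha
      generalize p.takeUntil a ha = p₁ at hsplit
      generalize p.dropUntil a ha = p₂ at hsplit
      subst hsplit
      refine ⟨p₁.append (Walk.cons hab (Walk.cons hab.symm p₂)), fun e => ?_, ?_⟩
      · have h2 := hp e
        have h0 : (p₁.append p₂).edges.count s(a, b) = 0 := List.count_eq_zero.2 fun hmem =>
          hb (Walk.snd_mem_support_of_mem_edges _ hmem)
        rw [Walk.edges_append, List.count_append] at h2 h0
        rw [Walk.edges_append, List.count_append, Walk.edges_cons, Walk.edges_cons,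
          List.count_cons, List.count_cons, Sym2.eq_swap (a := b)]
        by_cases hea : e = s(a, b)
        · subst hea
          simp only [beq_self_eq_true, if_true]
          omega
        · have : (s(a, b) == e) = false := by simpa using Ne.symm hea
          simp only [this]
          simpa using h2
      · have hsub : insert b (p₁.append p₂).support.toFinset ⊆
            (p₁.append (Walk.cons hab (Walk.cons hab.symm p₂))).support.toFinset := by
          intro x
          simp only [Finset.mem_insert, List.mem_toFinset, Walk.mem_support_append_iff,
            Walk.support_cons, List.mem_cons]
          tauto
        refine le_trans ?_ (Finset.card_le_card hsub)
        rw [Finset.card_insert_of_notMem (by simpa using hb)]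
        omega
  obtain ⟨p, -, hp⟩ := key (Fintype.card V + 1)
  exact absurd (hp.trans (Finset.card_le_univ _)) (by omega)

end Graph

/-! ### Spanning trees: edge exchange and comparison of costs. -/

section SpanningTree

variable {U : Type*}

theorem edgeSet_fromEdgeSet_of_subset {F : Finset (Sym2 U)}
    (hF : (F : Set (Sym2 U)) ⊆ (⊤ : SimpleGraph U).edgeSet) :
    (fromEdgeSet (F : Set (Sym2 U))).edgeSet = F := by
  rw [edgeSet_fromEdgeSet, sdiff_eq_left, Set.disjoint_left]
  intro e he
  simpa using hF he

theorem isSpanningTree_iff [Finite U] {F : Finset (Sym2 U)} :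
    IsSpanningTree F ↔ (F : Set (Sym2 U)) ⊆ (⊤ : SimpleGraph U).edgeSet ∧
      (fromEdgeSet (F : Set (Sym2 U))).Connected ∧ F.card + 1 = Nat.card U := by
  refine and_congr_right fun hF => ?_
  rw [isTree_iff_connected_and_card, edgeSet_fromEdgeSet_of_subset hF]
  simp

theorem card_le_of_connected [Finite U] {F : Finset (Sym2 U)}
    (hF : (F : Set (Sym2 U)) ⊆ (⊤ : SimpleGraph U).edgeSet)
    (hc : (fromEdgeSet (F : Set (Sym2 U))).Connected) : Nat.card U ≤ F.card + 1 := by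
  have := hc.card_vert_le_card_edgeSet_add_one
  rw [edgeSet_fromEdgeSet_of_subset hF] at this
  simpa using this

theorem exists_isSpanningTree_subset [Finite U] {F : Finset (Sym2 U)}
    (hc : (fromEdgeSet (F : Set (Sym2 U))).Connected) :
    ∃ F' ⊆ F, IsSpanningTree F' := by
  classical
  obtain ⟨K, hK, hKt⟩ := hc.exists_isTree_le
  have hsub : K.edgeSet ⊆ F := (edgeSet_mono hK).trans (by simp)
  have hcoe : ((F.filter (· ∈ K.edgeSet) : Finset (Sym2 U)) : Set (Sym2 U)) = K.edgeSet := by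
    ext e
    simpa using fun he => hsub he
  refine ⟨F.filter (· ∈ K.edgeSet), Finset.filter_subset _ _, ?_, ?_⟩
  · rw [hcoe]
    exact edgeSet_mono le_top
  · rwa [hcoe, fromEdgeSet_edgeSet]

theorem exists_isMST [Finite U] [Nonempty U] (c : Sym2 U → ℝ) : ∃ F, IsMST c F := by
  classical
  have := Fintype.ofFinite U
  obtain ⟨F₀, -, hF₀⟩ := exists_isSpanningTree_subset (U := U) (F := Finset.univ) (by
    simp [connected_top])
  obtain ⟨F, hF, hmin⟩ := Finset.exists_min_image
    (Finset.univ.filter fun F : Finset (Sym2 U) => IsSpanningTree F) (weight c)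
    ⟨F₀, by simpa using hF₀⟩
  exact ⟨F, by simpa using hF, fun F' hF' => hmin F' (by simpa using hF')⟩

/-- Edge exchange: an edge of the tree path between `u` and `v` can be replaced
by `s(u, v)`. -/
theorem IsSpanningTree.exchange [Finite U] [DecidableEq U] {F : Finset (Sym2 U)}
    (hF : IsSpanningTree F) {u v : U} (huv : u ≠ v)
    (p : (fromEdgeSet (F : Set (Sym2 U))).Walk u v) (hp : p.IsPath) {e : Sym2 U}
    (he : e ∈ p.edges) : IsSpanningTree (insert s(u, v) (F.erase e)) := by
  obtain ⟨hd, hconn, hcard⟩ := isSpanningTree_iff.1 hF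
  have heF : e ∈ F := by
    have := p.edges_subset_edgeSet he
    rwa [edgeSet_fromEdgeSet_of_subset hd] at this
  set H' : Finset (Sym2 U) := insert s(u, v) (F.erase e) with hH'
  have hd' : (H' : Set (Sym2 U)) ⊆ (⊤ : SimpleGraph U).edgeSet := by
    intro f hf
    simp only [hH', Finset.coe_insert, Set.mem_insert_iff, Finset.mem_coe, Finset.mem_erase] at hf
    rcases hf with rfl | hf
    · simpa using huv
    · exact hd hf.2
  have hstep : ∀ a b, (fromEdgeSet (F : Set (Sym2 U))).Adj a b → s(a, b) ≠ e →
      (fromEdgeSet (H' : Set (Sym2 U))).Adj a b := by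
    intro a b hab hne
    rw [fromEdgeSet_adj] at hab ⊢
    exact ⟨Finset.mem_insert_of_mem (Finset.mem_erase.2 ⟨hne, hab.1⟩), hab.2⟩
  have huv' : (fromEdgeSet (H' : Set (Sym2 U))).Adj u v := by
    rw [fromEdgeSet_adj]
    exact ⟨by simp [hH'], huv⟩
  obtain ⟨x, y, hxy, hux, hyv⟩ := reachable_split_of_mem_edges hstep p hp he
  -- The removed edge is bypassed by the rest of the cycle, through the new edge.
  have hr : (fromEdgeSet (H' : Set (Sym2 U))).Reachable x y :=
    hux.symm.trans (huv'.reachable.trans hyv.symm)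
  have hconn' : (fromEdgeSet (H' : Set (Sym2 U))).Connected := by
    have := hconn.nonempty
    refine ⟨fun a b => reachable_of_adj_reachable (fun a b hab => ?_) (hconn a b)⟩
    by_cases hne : s(a, b) = e
    · rw [hxy, Sym2.eq_iff] at hne
      rcases hne with ⟨rfl, rfl⟩ | ⟨rfl, rfl⟩
      · exact hr
      · exact hr.symm
    · exact (hstep a b hab hne).reachable
  refine isSpanningTree_iff.2 ⟨hd', hconn', le_antisymm ?_ (card_le_of_connected hd' hconn')⟩
  have h1 : H'.card ≤ (F.erase e).card + 1 := Finset.card_insert_le _ _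
  have h2 := Finset.card_erase_add_one heF
  omega

/-- A minimum spanning tree is dominated edge by edge by any other spanning tree. -/
theorem IsMST.exists_injective_le [Finite U] {c : Sym2 U → ℝ} {F F' : Finset (Sym2 U)}
    (hF : IsMST c F) (hF' : IsSpanningTree F') :
    ∃ φ : F → Sym2 U, Function.Injective φ ∧ ∀ e, φ e ∈ F' ∧ c e ≤ c (φ e) := by
  classical
  obtain ⟨hd, hconn, hcard⟩ := isSpanningTree_iff.1 hF.1
  obtain ⟨hd', hconn', -⟩ := isSpanningTree_iff.1 hF'
  let N : F → Finset (Sym2 U) := fun e =>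
    F'.filter fun f => IsSpanningTree (insert f (F.erase (e : Sym2 U)))
  -- Hall's condition: trading `A` for its neighbours `N` keeps the graph connected, and a connected
  -- graph has at least as many edges as the tree `F`. Indeed, an edge of `F'` whose `F`-path meets
  -- `A` is itself a neighbour; otherwise that path survives.
  have hall : ∀ A : Finset F, A.card ≤ (A.biUnion N).card := by
    intro A
    let B : Finset (Sym2 U) := A.map (Function.Embedding.subtype _)
    have hB : B ⊆ F := by
      intro e he
      obtain ⟨a, -, rfl⟩ := Finset.mem_map.1 he
      exact a.2
    let H : Finset (Sym2 U) := (F \ B) ∪ A.biUnion N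
    have hHd : (H : Set (Sym2 U)) ⊆ (⊤ : SimpleGraph U).edgeSet := by
      intro f hf
      rcases Finset.mem_union.1 (Finset.mem_coe.1 hf) with hf | hf
      · exact hd (Finset.sdiff_subset hf)
      · obtain ⟨a, -, hfa⟩ := Finset.mem_biUnion.1 hf
        exact hd' (Finset.filter_subset _ _ hfa)
    have hHc : (fromEdgeSet (H : Set (Sym2 U))).Connected := by
      have := hconn.nonempty
      refine ⟨fun a b => reachable_of_adj_reachable (fun u v huv => ?_) (hconn' a b)⟩
      rw [fromEdgeSet_adj] at huv
      obtain ⟨p, hp⟩ := (hconn u v).exists_isPath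
      by_cases hpB : ∃ e ∈ p.edges, e ∈ B
      · obtain ⟨e, hep, heB⟩ := hpB
        obtain ⟨a, haA, rfl⟩ := Finset.mem_map.1 heB
        refine Adj.reachable ?_
        rw [fromEdgeSet_adj]
        refine ⟨Finset.mem_union_right _ (Finset.mem_biUnion.2 ⟨a, haA, ?_⟩), huv.2⟩
        exact Finset.mem_filter.2 ⟨huv.1, hF.1.exchange huv.2 p hp hep⟩
      · push Not at hpB
        refine ⟨p.transfer _ fun f hf => ?_⟩
        have hfF := p.edges_subset_edgeSet hf
        rw [edgeSet_fromEdgeSet_of_subset hd] at hfF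
        rw [edgeSet_fromEdgeSet_of_subset hHd]
        exact Finset.mem_union_left _ (Finset.mem_sdiff.2 ⟨hfF, hpB f hf⟩)
    have h1 := card_le_of_connected hHd hHc
    have h2 : H.card ≤ (F \ B).card + (A.biUnion N).card := Finset.card_union_le _ _
    have h3 := Finset.card_sdiff_add_card_eq_card hB
    have h4 : B.card = A.card := Finset.card_map _
    omega
  obtain ⟨φ, hφ, hmem⟩ := (Finset.all_card_le_biUnion_card_iff_exists_injective N).1 hall
  refine ⟨φ, hφ, fun e => ?_⟩
  obtain ⟨hm, ht⟩ := Finset.mem_filter.1 (hmem e)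
  refine ⟨hm, ?_⟩
  -- Otherwise the exchanged tree would have one edge too few.
  have hnot : φ e ∉ F.erase (e : Sym2 U) := by
    intro hin
    rw [Finset.insert_eq_of_mem hin] at ht
    have h1 := (isSpanningTree_iff.1 ht).2.2
    have h2 := Finset.card_erase_add_one e.2
    omega
  have hle := hF.2 _ ht
  rw [weight, weight, Finset.sum_insert hnot, ← Finset.add_sum_erase F c e.2] at hle
  linarith

/-- The most expensive edges bound any set of at most as many edges. -/
theorem IsMostExpensive.sum_le {ι : Type*} {c : ι → ℝ} {F S R : Finset ι} {m : ℕ}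
    (hS : IsMostExpensive c F m S) (hc : ∀ e ∈ F, 0 ≤ c e) (hR : R ⊆ F) (hm : R.card ≤ m) :
    ∑ e ∈ R, c e ≤ ∑ e ∈ S, c e := by
  classical
  obtain ⟨hSF, hcard, hmax⟩ := hS
  -- The common part cancels; `R \ S` then injects into `S \ R`, where every edge is at least as
  -- expensive.
  rw [← Finset.sum_inter_add_sum_sdiff R S, ← Finset.sum_inter_add_sum_sdiff S R,
    Finset.inter_comm S R]
  refine add_le_add_right ?_ _
  have hle : (R \ S).card ≤ (S \ R).card := by
    have h1 := Finset.card_sdiff_add_card_inter R S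
    have h2 := Finset.card_sdiff_add_card_inter S R
    rw [Finset.inter_comm S R] at h2
    omega
  obtain ⟨Q, hQ, hQc⟩ := Finset.exists_subset_card_eq hle
  obtain ⟨ψ⟩ : Nonempty (↥(R \ S) ≃ Q) := ⟨Finset.equivOfCardEq hQc.symm⟩
  calc ∑ e ∈ R \ S, c e = ∑ e : ↥(R \ S), c e := (Finset.sum_coe_sort _ _).symm
    _ ≤ ∑ e : ↥(R \ S), c (ψ e) := Finset.sum_le_sum fun e _ => by
        have he := Finset.mem_sdiff.1 e.2
        exact hmax _ (Finset.mem_sdiff.1 (hQ (ψ e).2)).1 _ (hR he.1) he.2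
    _ = ∑ e : Q, c e := Equiv.sum_comp ψ fun e : Q => c e
    _ = ∑ e ∈ Q, c e := Finset.sum_coe_sort _ _
    _ ≤ ∑ e ∈ S \ R, c e := Finset.sum_le_sum_of_subset_of_nonneg hQ fun e he _ =>
        hc e (hSF (Finset.mem_sdiff.1 he).1)

end SpanningTree

/-! ### The metric closure and the factor-two bound. -/

section Closure

variable {V : Type*} {G : SimpleGraph V} {u : Sym2 V → ℝ}

theorem weight_nonneg (hu : ∀ e ∈ G.edgeSet, 0 ≤ u e) {P : Finset (Sym2 V)}
    (hP : (P : Set (Sym2 V)) ⊆ G.edgeSet) : 0 ≤ weight u P :=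
  Finset.sum_nonneg fun e he => hu e (hP he)

theorem weight_le_of_subset (hu : ∀ e ∈ G.edgeSet, 0 ≤ u e) {P Q : Finset (Sym2 V)}
    (hPQ : P ⊆ Q) (hQ : (Q : Set (Sym2 V)) ⊆ G.edgeSet) : weight u P ≤ weight u Q :=
  Finset.sum_le_sum_of_subset_of_nonneg hPQ fun e he _ => hu e (hQ he)

theorem weight_biUnion_le {ι : Type*} [DecidableEq V] (hu : ∀ e ∈ G.edgeSet, 0 ≤ u e)
    (F : Finset ι) (p : ι → Finset (Sym2 V))
    (hp : ∀ i ∈ F, (p i : Set (Sym2 V)) ⊆ G.edgeSet) :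
    weight u (F.biUnion p) ≤ ∑ i ∈ F, weight u (p i) := by
  classical
  induction F using Finset.induction_on with
  | empty => simp [weight]
  | insert a F ha ih =>
    have ih' := ih fun i hi => hp i (Finset.mem_insert_of_mem hi)
    rw [Finset.biUnion_insert, Finset.sum_insert ha]
    have hun : weight u (p a ∪ F.biUnion p) + weight u (p a ∩ F.biUnion p) =
      weight u (p a) + weight u (F.biUnion p) := Finset.sum_union_inter
    have hnn : 0 ≤ weight u (p a ∩ F.biUnion p) := weight_nonneg hu fun e he =>
      hp a (Finset.mem_insert_self _ _) (Finset.mem_inter.1 he).1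
    linarith

theorem IsPathEdges.subset_edgeSet {e : Sym2 V} {P : Finset (Sym2 V)} (h : IsPathEdges G e P) :
    (P : Set (Sym2 V)) ⊆ G.edgeSet := by
  obtain ⟨_, _, p, -, -, hP⟩ := h
  exact fun x hx => p.edges_subset_edgeSet ((hP x).1 hx)

theorem isPathEdges_toFinset [DecidableEq V] {a b : V} (p : G.Walk a b) (hp : p.IsPath) :
    IsPathEdges G s(a, b) p.edges.toFinset :=
  ⟨a, b, p, hp, rfl, by simp⟩

/-- The ends of a path are connected by its edges. -/
theorem IsPathEdges.reachable {a b : V} {P : Finset (Sym2 V)} (h : IsPathEdges G s(a, b) P) :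
    (fromEdgeSet (P : Set (Sym2 V))).Reachable a b := by
  obtain ⟨x, y, p, -, hxy, hP⟩ := h
  have hr : (fromEdgeSet (P : Set (Sym2 V))).Reachable x y := by
    refine ⟨p.transfer _ fun f hf => ?_⟩
    rw [edgeSet_fromEdgeSet]
    exact ⟨(hP f).2 hf, G.not_isDiag_of_mem_edgeSet (p.edges_subset_edgeSet hf)⟩
  rw [Sym2.eq_iff] at hxy
  rcases hxy with ⟨rfl, rfl⟩ | ⟨rfl, rfl⟩
  · exact hr
  · exact hr.symm

theorem closureCost_le (hu : ∀ e ∈ G.edgeSet, 0 ≤ u e) {T : Finset V} {e : Sym2 T}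
    {P : Finset (Sym2 V)} (hP : IsPathEdges G (e.map Subtype.val) P) :
    closureCost G u e ≤ weight u P := by
  refine csInf_le ⟨0, ?_⟩ ⟨P, hP, rfl⟩
  rintro _ ⟨Q, hQ, rfl⟩
  exact weight_nonneg hu hQ.subset_edgeSet

theorem closureCost_nonneg (hu : ∀ e ∈ G.edgeSet, 0 ≤ u e) {T : Finset V} (e : Sym2 T) :
    0 ≤ closureCost G u e := by
  -- This also covers ends not connected in `G`, where the infimum of the empty set is 0.
  refine Real.sInf_nonneg ?_
  rintro _ ⟨Q, hQ, rfl⟩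
  exact weight_nonneg hu hQ.subset_edgeSet

theorem IsCheapestPath.closureCost_eq (hu : ∀ e ∈ G.edgeSet, 0 ≤ u e) {T : Finset V} {e : Sym2 T}
    {P : Finset (Sym2 V)} (hP : IsCheapestPath G u (e.map Subtype.val) P) :
    closureCost G u e = weight u P := by
  refine le_antisymm (closureCost_le hu hP.1) (le_csInf ⟨_, P, hP.1, rfl⟩ ?_)
  rintro _ ⟨Q, hQ, rfl⟩
  exact hP.2 Q hQ

theorem exists_isCheapestPath [Finite V] {a b : V} (h : G.Reachable a b) :
    ∃ P, IsCheapestPath G u s(a, b) P := by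
  classical
  have := Fintype.ofFinite V
  obtain ⟨p, hp⟩ := h.exists_isPath
  obtain ⟨P, hP, hmin⟩ := Finset.exists_min_image
    (Finset.univ.filter fun P : Finset (Sym2 V) => IsPathEdges G s(a, b) P) (weight u)
    ⟨_, by simpa using isPathEdges_toFinset p hp⟩
  exact ⟨P, by simpa using hP, fun Q hQ => hmin Q (by simpa using hQ)⟩

theorem closureCost_mono [Finite V] {u' : Sym2 V → ℝ} (hu : ∀ e ∈ G.edgeSet, 0 ≤ u e)
    (huu' : ∀ e ∈ G.edgeSet, u e ≤ u' e) {T : Finset V} {s t : T}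
    (h : G.Reachable (s : V) t) : closureCost G u s(s, t) ≤ closureCost G u' s(s, t) := by
  obtain ⟨P, hP⟩ := exists_isCheapestPath (u := u') h
  rw [IsCheapestPath.closureCost_eq (fun e he => (hu e he).trans (huu' e he)) (e := s(s, t)) hP]
  exact (closureCost_le hu (e := s(s, t)) hP.1).trans
    (Finset.sum_le_sum fun e he => huu' e (hP.1.subset_edgeSet he))

/-- A walk contains the edges of a path with the same ends, and counts each of them at least once.
-/
theorem closureCost_le_walk (hu : ∀ e ∈ G.edgeSet, 0 ≤ u e) {T : Finset V} {s t : T}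
    (p : G.Walk (s : V) t) : closureCost G u s(s, t) ≤ (p.edges.map u).sum := by
  classical
  have hpath := isPathEdges_toFinset (p.toPath : G.Walk (s : V) t) p.toPath.2
  refine (closureCost_le hu (e := s(s, t)) hpath).trans ?_
  rw [weight, Finset.sum_list_map_count]
  have hsub : (p.toPath : G.Walk (s : V) t).edges.toFinset ⊆ p.edges.toFinset := by
    intro f hf
    rw [List.mem_toFinset] at hf ⊢
    exact p.edges_toPath_subset_edges hf
  have hnn : ∀ f ∈ p.edges.toFinset, 0 ≤ u f := fun f hf =>
    hu f (p.edges_subset_edgeSet (List.mem_toFinset.1 hf))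
  refine (Finset.sum_le_sum_of_subset_of_nonneg hsub fun f hf _ => hnn f hf).trans
    (Finset.sum_le_sum fun f hf => ?_)
  have hcount : 1 ≤ p.edges.count f := List.count_pos_iff.2 (List.mem_toFinset.1 hf)
  rw [nsmul_eq_mul]
  exact le_mul_of_one_le_left (hnn f hf) (by exact_mod_cast hcount)

theorem weight_insert_le {ι : Type*} [DecidableEq ι] {c : ι → ℝ} (e : ι) (F : Finset ι)
    (he : 0 ≤ c e) : weight c (insert e F) ≤ c e + weight c F := by
  by_cases h : e ∈ F
  · rw [Finset.insert_eq_of_mem h]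
    linarith
  · rw [weight, Finset.sum_insert h, weight]

/-- Shortcutting a walk to the terminals it visits. -/
theorem exists_shortcut (hu : ∀ e ∈ G.edgeSet, 0 ≤ u e) {T : Finset V} {x y : V}
    (p : G.Walk x y) : ∀ (a : T) (q : G.Walk (a : V) x), ∃ F : Finset (Sym2 T),
      weight (closureCost G u) F ≤ (q.edges.map u).sum + (p.edges.map u).sum ∧
      ∀ t : T, (t : V) ∈ p.support → (fromEdgeSet (F : Set (Sym2 T))).Reachable a t := by
  classical
  have hadd : ∀ (a b : T) (F : Finset (Sym2 T)),
      (fromEdgeSet ((insert s(a, b) F : Finset (Sym2 T)) : Set (Sym2 T))).Reachable a b := by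
    intro a b F
    by_cases hab : a = b
    · rw [hab]
    · refine Adj.reachable ?_
      rw [fromEdgeSet_adj]
      exact ⟨by simp, hab⟩
  have hmono : ∀ (e : Sym2 T) (F : Finset (Sym2 T)),
      fromEdgeSet (F : Set (Sym2 T)) ≤
        fromEdgeSet ((insert e F : Finset (Sym2 T)) : Set (Sym2 T)) := fun e F =>
    fromEdgeSet_mono (by simp)
  have hlen : ∀ {a b : V} (q : G.Walk a b), 0 ≤ (q.edges.map u).sum := fun q =>
    List.sum_nonneg fun z hz => by
      obtain ⟨f, hf, rfl⟩ := List.mem_map.1 hz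
      exact hu f (q.edges_subset_edgeSet hf)
  -- Here `a` is the last terminal recorded and `q` the stretch walked since. At a terminal `b`, the
  -- pair `s(a, b)` is paid for by `q`, which then restarts. A loop `s(a, a)` may enter `F`, but
  -- `fromEdgeSet` ignores it.
  induction p with
  | @nil x =>
    intro a q
    by_cases hx : x ∈ T
    · obtain ⟨b, rfl⟩ : ∃ b : T, (b : V) = x := ⟨⟨x, hx⟩, rfl⟩
      refine ⟨insert s(a, b) ∅, ?_, fun t ht => ?_⟩
      · refine (weight_insert_le _ _ (closureCost_nonneg hu _)).trans ?_
        simpa [weight] using closureCost_le_walk hu q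
      · obtain rfl : t = b := Subtype.ext (by simpa using ht)
        exact hadd _ _ _
    · refine ⟨∅, by simpa [weight] using hlen q, fun t ht => absurd t.2 ?_⟩
      rw [Walk.support_nil, List.mem_singleton] at ht
      rwa [ht]
  | @cons x z y hxz p ih =>
    intro a q
    by_cases hx : x ∈ T
    · obtain ⟨b, rfl⟩ : ∃ b : T, (b : V) = x := ⟨⟨x, hx⟩, rfl⟩
      obtain ⟨F, hF, hr⟩ := ih b (Walk.cons hxz Walk.nil)
      refine ⟨insert s(a, b) F, ?_, fun t ht => ?_⟩
      · have h1 := weight_insert_le _ F (closureCost_nonneg hu s(a, b))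
        have h2 := closureCost_le_walk hu q
        simp only [Walk.edges_cons, Walk.edges_nil, List.map_cons, List.map_nil, List.sum_cons,
          List.sum_nil] at hF ⊢
        linarith
      · rw [Walk.support_cons, List.mem_cons] at ht
        rcases ht with ht | ht
        · obtain rfl : t = b := Subtype.ext ht
          exact hadd _ _ _
        · exact (hadd a b F).trans ((hr t ht).mono (hmono _ _))
    · obtain ⟨F, hF, hr⟩ := ih a (q.concat hxz)
      refine ⟨F, ?_, fun t ht => ?_⟩
      · simp only [Walk.edges_concat, Walk.edges_cons, List.concat_eq_append, List.map_append,
          List.map_cons, List.map_nil, List.sum_append, List.sum_cons, List.sum_nil] at hF ⊢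
        linarith
      · rw [Walk.support_cons, List.mem_cons] at ht
        rcases ht with ht | ht
        · exact absurd t.2 (by rwa [ht])
        · exact hr t ht

theorem IsSteinerTree.fromEdgeSet_le {T : Finset V} {X : Finset (Sym2 V)}
    (hX : IsSteinerTree G T X) : fromEdgeSet (X : Set (Sym2 V)) ≤ G := by
  intro a b hab
  exact hX.1 ((fromEdgeSet_adj _).1 hab).1

/-- The metric closure has a spanning tree of cost at most twice that of any Steiner tree. -/
theorem IsSteinerTree.exists_isSpanningTree_le [Finite V] (hu : ∀ e ∈ G.edgeSet, 0 ≤ u e)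
    {T : Finset V} (hT : T.Nonempty) {X : Finset (Sym2 V)} (hX : IsSteinerTree G T X) :
    ∃ F : Finset (Sym2 T), IsSpanningTree F ∧ weight (closureCost G u) F ≤ 2 * weight u X := by
  classical
  have := Fintype.ofFinite V
  obtain ⟨r, hr⟩ := hT
  obtain ⟨p, hp2, hpr⟩ := exists_closed_walk_count_le_two (fromEdgeSet (X : Set (Sym2 V))) r
  obtain ⟨F, hF, hFr⟩ := exists_shortcut hu (p.mapLe hX.fromEdgeSet_le) (⟨r, hr⟩ : T) Walk.nil
  rw [Walk.edges_mapLe_eq_edges, Walk.support_mapLe_eq_support] at *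
  have hconn : (fromEdgeSet (F : Set (Sym2 T))).Connected := by
    have : Nonempty T := ⟨⟨r, hr⟩⟩
    have hall : ∀ t : T, (fromEdgeSet (F : Set (Sym2 T))).Reachable ⟨r, hr⟩ t := fun t =>
      hFr t (hpr t (hX.2 r hr t t.2))
    exact ⟨fun s t => (hall s).symm.trans (hall t)⟩
  obtain ⟨F', hF', ht⟩ := exists_isSpanningTree_subset hconn
  refine ⟨F', ht, ?_⟩
  have h1 : weight (closureCost G u) F' ≤ weight (closureCost G u) F :=
    Finset.sum_le_sum_of_subset_of_nonneg hF' fun e _ _ => closureCost_nonneg hu e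
  have hpX : p.edges.toFinset ⊆ X := by
    intro f hf
    have := p.edges_subset_edgeSet (List.mem_toFinset.1 hf)
    rw [edgeSet_fromEdgeSet] at this
    exact this.1
  have h2 : (p.edges.map u).sum ≤ 2 * weight u X := by
    rw [Finset.sum_list_map_count, weight, Finset.mul_sum]
    refine le_trans (Finset.sum_le_sum fun f hf => ?_)
      (Finset.sum_le_sum_of_subset_of_nonneg hpX fun f hf _ =>
        mul_nonneg zero_le_two (hu f (hX.1 hf)))
    rw [nsmul_eq_mul]
    exact mul_le_mul_of_nonneg_right (by exact_mod_cast hp2 f) (hu f (hX.1 (hpX hf)))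
  simp only [Walk.edges_nil, List.map_nil, List.sum_nil, zero_add] at hF
  linarith

end Closure

/-! ### Outputs of the algorithm: existence, feasibility and cost. -/

section Algorithm

variable {V : Type*} [DecidableEq V] {G : SimpleGraph V} {w : Sym2 V → ℝ} {T : Finset V}
  {Xhat : Finset (Sym2 V)} {α : ℝ}

theorem scaledWeight_nonneg (hw : ∀ e ∈ G.edgeSet, 0 ≤ w e) (hα : 1 ≤ α) :
    ∀ e ∈ G.edgeSet, 0 ≤ scaledWeight w Xhat α e := by
  intro e he
  unfold scaledWeight
  split_ifs
  · exact div_nonneg (hw e he) (by linarith)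
  · exact hw e he

theorem scaledWeight_le (hw : ∀ e ∈ G.edgeSet, 0 ≤ w e) (hα : 1 ≤ α) :
    ∀ e ∈ G.edgeSet, scaledWeight w Xhat α e ≤ w e := by
  intro e he
  unfold scaledWeight
  split_ifs
  · exact div_le_self (hw e he) hα
  · exact le_rfl

theorem weight_scaledWeight (X : Finset (Sym2 V)) :
    weight (scaledWeight w Xhat α) X = weight w (X ∩ Xhat) / α + weight w (X \ Xhat) := by
  have h : weight (scaledWeight w Xhat α) X = ∑ e ∈ X, if e ∈ Xhat then w e / α else w e := rfl
  rw [h, Finset.sum_ite, Finset.filter_mem_eq_inter, Finset.filter_notMem_eq_sdiff,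
    ← Finset.sum_div, weight, weight]

theorem IsOutput.exists [Finite V] (hT : T.Nonempty) {X' : Finset (Sym2 V)}
    (hX' : IsSteinerTree G T X') : ∃ X, IsOutput G w T Xhat α X := by
  have : Nonempty T := hT.to_subtype
  obtain ⟨F, hF⟩ := exists_isMST (closureCost G (scaledWeight w Xhat α) (T := T))
  have hp : ∀ e : Sym2 T, ∃ P,
      IsCheapestPath G (scaledWeight w Xhat α) (e.map Subtype.val) P := by
    intro e
    induction e with
    | _ s t => exact exists_isCheapestPath ((hX'.2 s s.2 t t.2).mono hX'.fromEdgeSet_le)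
  choose p hp using hp
  exact ⟨_, F, p, hF, fun e _ => hp e, rfl⟩

theorem IsOutput.isSteinerTree {X : Finset (Sym2 V)} (hX : IsOutput G w T Xhat α X) :
    IsSteinerTree G T X := by
  obtain ⟨F, p, hF, hp, rfl⟩ := hX
  constructor
  · intro f hf
    obtain ⟨e, he, hfe⟩ := Finset.mem_biUnion.1 (Finset.mem_coe.1 hf)
    exact (hp e he).1.subset_edgeSet hfe
  · intro s hs t ht
    obtain ⟨q⟩ := hF.1.2.connected ⟨s, hs⟩ ⟨t, ht⟩
    suffices h : ∀ {a b : T}, (fromEdgeSet (F : Set (Sym2 T))).Walk a b →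
        (fromEdgeSet ((F.biUnion p : Finset (Sym2 V)) : Set (Sym2 V))).Reachable (a : V) b from
      h q
    intro a b q
    induction q with
    | nil => exact Reachable.refl _
    | @cons a b _ hab _ ih =>
      have he := ((fromEdgeSet_adj _).1 hab).1
      have hr := IsPathEdges.reachable (a := (a : V)) (b := b) (hp _ he).1
      refine (hr.mono (fromEdgeSet_mono ?_)).trans ih
      exact Finset.coe_subset.2 (Finset.subset_biUnion_of_mem p he)

/-- The paths that contain a set `Z` of output edges cost, with the scaled weights, no more than
the most expensive edges of a minimum spanning tree of the unscaled metric closure. -/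
theorem weight_scaledWeight_le_sum_mostExpensive [Finite V] (hw : ∀ e ∈ G.edgeSet, 0 ≤ w e)
    (hα : 1 ≤ α) (hconn : ∀ s ∈ T, ∀ t ∈ T, G.Reachable s t)
    {F M S : Finset (Sym2 T)} {p : Sym2 T → Finset (Sym2 V)} {n : ℕ}
    (hF : IsMST (closureCost G (scaledWeight w Xhat α)) F)
    (hp : ∀ e ∈ F, IsCheapestPath G (scaledWeight w Xhat α) (e.map Subtype.val) (p e))
    (hM : IsSpanningTree M) (hS : IsMostExpensive (closureCost G w) M (min (T.card - 1) n) S)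
    {Z : Finset (Sym2 V)} (hZ : Z ⊆ F.biUnion p) (hZn : Z.card ≤ n) :
    weight (scaledWeight w Xhat α) Z ≤ ∑ e ∈ S, closureCost G w e := by
  classical
  have hs := scaledWeight_nonneg (Xhat := Xhat) hw hα
  have hsw := scaledWeight_le (Xhat := Xhat) hw hα
  have hpe : ∀ e ∈ F, (p e : Set (Sym2 V)) ⊆ G.edgeSet := fun e he => (hp e he).1.subset_edgeSet
  have hg : ∀ z : Z, ∃ e : F, (z : Sym2 V) ∈ p e := by
    intro z
    obtain ⟨e, he, hze⟩ := Finset.mem_biUnion.1 (hZ z.2)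
    exact ⟨⟨e, he⟩, hze⟩
  choose g hg using hg
  -- One tree edge is picked per element of `Z`, so `R` has at most `Z.card` elements, and at most k
  -- - 1 since it lies in a tree on `T`.
  let R : Finset F := Finset.univ.image g
  have hRZ : R.card ≤ Z.card :=
    Finset.card_image_le.trans_eq (by rw [Finset.card_univ, Fintype.card_coe])
  have hRF : R.card ≤ T.card - 1 := by
    have h1 : R.card ≤ F.card := by simpa using Finset.card_le_univ R
    have h2 := (isSpanningTree_iff.1 hF.1).2.2
    simp only [Nat.card_eq_fintype_card, Fintype.card_coe] at h2
    omega
  obtain ⟨φ, hφ, hφM⟩ := hF.exists_injective_le hM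
  have hZR : Z ⊆ R.biUnion fun e => p e := fun z hz =>
    Finset.mem_biUnion.2 ⟨g ⟨z, hz⟩, Finset.mem_image_of_mem g (Finset.mem_univ _), hg ⟨z, hz⟩⟩
  have hmono : ∀ e : Sym2 T, closureCost G (scaledWeight w Xhat α) e ≤ closureCost G w e := by
    intro e
    induction e with
    | _ s t => exact closureCost_mono hs hsw (hconn s s.2 t t.2)
  calc weight (scaledWeight w Xhat α) Z
      ≤ weight (scaledWeight w Xhat α) (R.biUnion fun e => p e) :=
        weight_le_of_subset hs hZR fun f hf => by
          obtain ⟨e, -, hfe⟩ := Finset.mem_biUnion.1 (Finset.mem_coe.1 hf)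
          exact hpe e e.2 hfe
    _ ≤ ∑ e ∈ R, weight (scaledWeight w Xhat α) (p e) :=
        weight_biUnion_le hs R (fun e => p e) fun e _ => hpe e e.2
    _ ≤ ∑ e ∈ R, closureCost G w (φ e) := Finset.sum_le_sum fun e _ => by
        rw [← (hp e e.2).closureCost_eq hs]
        exact (hφM e).2.trans (hmono _)
    _ = ∑ e ∈ R.image φ, closureCost G w e := (Finset.sum_image hφ.injOn).symm
    _ ≤ ∑ e ∈ S, closureCost G w e := by
        refine hS.sum_le (fun e _ => closureCost_nonneg hw e) ?_ ?_
        · intro e he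
          obtain ⟨e', -, rfl⟩ := Finset.mem_image.1 he
          exact (hφM e').1
        · exact Finset.card_image_le.trans (le_min hRF (hRZ.trans hZn))

theorem IsOutput.weight_le [Finite V] (hw : ∀ e ∈ G.edgeSet, 0 ≤ w e) (hT : T.Nonempty)
    (hXhat : (Xhat : Set (Sym2 V)) ⊆ G.edgeSet) (hα : 1 ≤ α) {X' : Finset (Sym2 V)}
    (hX' : IsSteinerTree G T X') {M S : Finset (Sym2 T)} (hM : IsSpanningTree M)
    (hS : IsMostExpensive (closureCost G w) M (min (T.card - 1) (Xhat \ X').card) S)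
    {X : Finset (Sym2 V)} (hX : IsOutput G w T Xhat α X) :
    weight w X ≤ (1 + 1 / α) * weight w X' + (1 - 1 / α) * weight w (X' \ Xhat)
      + min (weight w (Xhat \ X')) ((α - 1) * ∑ e ∈ S, closureCost G w e) := by
  obtain ⟨F, p, hF, hp, rfl⟩ := hX
  set X := F.biUnion p
  have hs := scaledWeight_nonneg (Xhat := Xhat) hw hα
  have hα0 : 0 < α := by linarith
  have hinv : 1 / α ≤ 1 := (div_le_one hα0).2 hα
  have hinv0 : 0 < 1 / α := by positivity
  let Z := (X ∩ Xhat) \ X'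
  have hZX : Z ⊆ X := Finset.sdiff_subset.trans Finset.inter_subset_left
  have hZη : Z ⊆ Xhat \ X' := Finset.sdiff_subset_sdiff Finset.inter_subset_right le_rfl
  have hηsub : ((Xhat \ X' : Finset (Sym2 V)) : Set (Sym2 V)) ⊆ G.edgeSet := fun e he =>
    hXhat (Finset.mem_sdiff.1 he).1
  have hZ0 : 0 ≤ weight w Z := weight_nonneg hw fun e he => hηsub (hZη he)
  have hZ1 : weight w Z ≤ weight w (Xhat \ X') := weight_le_of_subset hw hZη hηsub
  have hZ2 : weight w Z / α ≤ ∑ e ∈ S, closureCost G w e := by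
    have h := weight_scaledWeight_le_sum_mostExpensive hw hα
      (fun s hs t ht => (hX'.2 s hs t ht).mono hX'.fromEdgeSet_le) hF hp hM hS hZX
      (Finset.card_le_card hZη)
    have hin : Z ∩ Xhat = Z :=
      Finset.inter_eq_left.2 (Finset.sdiff_subset.trans Finset.inter_subset_right)
    have hout : Z \ Xhat = ∅ :=
      Finset.sdiff_eq_empty_iff_subset.2 (Finset.sdiff_subset.trans Finset.inter_subset_right)
    rw [weight_scaledWeight, hin, hout] at h
    simpa [weight] using h
  have hmin : (1 - 1 / α) * weight w Z ≤
      min (weight w (Xhat \ X')) ((α - 1) * ∑ e ∈ S, closureCost G w e) := by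
    refine le_min ?_ ?_
    · nlinarith [mul_nonneg hinv0.le hZ0]
    · have h := mul_le_mul_of_nonneg_left hZ2 (sub_nonneg.2 hα)
      have heq : (α - 1) * (weight w Z / α) = (1 - 1 / α) * weight w Z := by
        field_simp
      linarith
  have htree : weight (scaledWeight w Xhat α) X ≤ 2 * weight (scaledWeight w Xhat α) X' := by
    obtain ⟨F', hF', hle⟩ := hX'.exists_isSpanningTree_le hs hT
    refine le_trans (weight_biUnion_le hs F p fun e he => (hp e he).1.subset_edgeSet) ?_
    refine le_trans (le_of_eq ?_) ((hF.2 F' hF').trans hle)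
    exact Finset.sum_congr rfl fun e he => ((hp e he).closureCost_eq hs).symm
  rw [weight_scaledWeight, weight_scaledWeight] at htree
  have hX1 : weight w (X ∩ Xhat) + weight w (X \ Xhat) = weight w X :=
    Finset.sum_inter_add_sum_sdiff X Xhat w
  have hX2 : weight w (X' ∩ Xhat) + weight w (X' \ Xhat) = weight w X' :=
    Finset.sum_inter_add_sum_sdiff X' Xhat w
  have hX3 : weight w ((X ∩ Xhat) ∩ X') + weight w Z = weight w (X ∩ Xhat) :=
    Finset.sum_inter_add_sum_sdiff (X ∩ Xhat) X' w
  have hX4 : weight w ((X ∩ Xhat) ∩ X') ≤ weight w (X' ∩ Xhat) := by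
    refine weight_le_of_subset hw (fun e he => ?_) fun e he => hX'.1 (Finset.mem_inter.1 he).1
    simp only [Finset.mem_inter] at he ⊢
    exact ⟨he.2, he.1.2⟩
  have hX5 := mul_le_mul_of_nonneg_left hX4 (sub_nonneg.2 hinv)
  -- What is left is linear: `htree` plus 1 - 1/α times the bound on the predicted part, with 2/α +
  -- (1 - 1/α) = 1 + 1/α on X' ∩ X̂ and 2 = (1 + 1/α) + (1 - 1/α) on X' \ X̂.
  refine le_trans ?_ (add_le_add_right hmin _)
  rw [← hX1, ← hX2, ← hX3]
  rw [← hX3] at htree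
  rw [div_eq_mul_one_div (_ + _) α, div_eq_mul_one_div (weight w (X' ∩ Xhat)) α] at htree
  linarith

end Algorithm

end SteinerPrediction

theorem mainTheorem3 {V : Type*} [Fintype V] [DecidableEq V] (G : SimpleGraph V)
    (w : Sym2 V → ℝ) (hw : ∀ e ∈ G.edgeSet, 0 ≤ w e)
    (T : Finset V) (hT : T.Nonempty)
    (Xhat : Finset (Sym2 V)) (hXhat : (Xhat : Set (Sym2 V)) ⊆ G.edgeSet)
    (α : ℝ) (hα : 1 ≤ α)
    (X' : Finset (Sym2 V)) (hX' : SteinerPrediction.IsSteinerTree G T X')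
    (M : Finset (Sym2 T))
    (hM : SteinerPrediction.IsMST (SteinerPrediction.closureCost G w) M)
    (S : Finset (Sym2 T))
    (hS : SteinerPrediction.IsMostExpensive (SteinerPrediction.closureCost G w) M
      (min (T.card - 1) (Xhat \ X').card) S) :
    (∃ X, SteinerPrediction.IsOutput G w T Xhat α X) ∧
    ∀ X, SteinerPrediction.IsOutput G w T Xhat α X →
      SteinerPrediction.IsSteinerTree G T X ∧
      SteinerPrediction.weight w X ≤
        (1 + 1 / α) * SteinerPrediction.weight w X'
          + (1 - 1 / α) * SteinerPrediction.weight w (X' \ Xhat)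
          + min (SteinerPrediction.weight w (Xhat \ X'))
              ((α - 1) * ∑ e ∈ S, SteinerPrediction.closureCost G w e) := by
  exact ⟨SteinerPrediction.IsOutput.exists hT hX', fun X hX =>
    ⟨hX.isSteinerTree, hX.weight_le hw hT hXhat hα hX' hM.1 hS⟩⟩
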